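/- **Theorem 2.** Let $X=(V,E,F)$ be a finite cell decomposition of the sphere with connected graph $(V,E)$ and at least one edge, each edge carrying an arbitrary reference orientation, and let $p:V\to\mathbb R^2$ be a realization in which the two ends of every edge are distinct points, so that edges are nondegenerate straight segments (the form diagram; planar straight-line drawings are a special case). For $u:V\to\mathbb R^2$ and an edge $e$ write $(du)_e=u(\text{head of }e)-u(\text{tail of }e)$; for $q:F\to\mathbb R^2$ write $(d^*q)_e=q(\text{left face of }e)-q(\text{right face of }e)$. The force cosheaf $\mathcal F$ has stalks $\mathbb R^2,\mathbb R,0$ on vertices, edges, faces; it includes into the constant cosheaf $\mathbb R^2_X$ by the identity on vertices and by $1\mapsto (dp)_e$ on edges. The position cosheaf is the quotient $\mathcal G=\mathbb R^2_X/\mathcal F$; it has edge stalks $\mathbb R^2/\mathbb R(dp)_e$ and vertex stalks $0$. An infinitesimal motion is $u:V\to\mathbb R^2$ with $\langle (dp)_e,(du)_e\rangle=0$ for all $e$; a mechanism is an infinitesimal motion that is not induced by a rigid motion of the plane; a global rotation is $u(v)=a\,J(p(v)-c)$ with $a\ne0$, where $J$ is the quarter turn; a translation is a constant $u$. The edge rotations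 of $u$ are the 1-chain $\big((du)_e \bmod (dp)_e\big)_e$ of $\mathcal G$. A parallel force diagram is an assignment $q:F\to\mathbb R^2$ of positions to the dual vertices that represents an element of $H_2\mathcal G$, i.e. $(d^*q)_e\parallel (dp)_e$ for all $e$. Then: 1. The map $[c]\mapsto\sum_v c_v$ is an isomorphism $H_0\mathbb R^2_X\cong\mathbb R^2$, and, with the connecting homomorphism $\delta$ of $0\to\mathcal F\to\mathbb R^2_X\to\mathcal G\to0$, $$0\to H_1\mathcal G\xrightarrow{\ \delta\ }H_0\mathcal F\to\mathbb R^2\to0$$ is exact, the second map being induced by the inclusion. Hence $H_0\mathcal F/H_1\mathcal G\cong\mathbb R^2$, and the classes of global translations form a complement of $\delta(H_1\mathcal G)$ in $H_0\mathcal F$. 2. Every class in $H_0\mathcal F$ is represented by exactly one infinitesimal motion. Every class in $H_1\mathcal G$ is the class of the edge rotations of some infinitesimal motion, and the edge rotations of an infinitesimal motion have zero class in $H_1\mathcal G$ if and only if it is a translation. 3. If $u$ is a mechanism or a global rotation, then $u$ is an infinitesimal motion and its edge rotations are impossible dual edge rotations: their class in $H_1\mathcal G$ is nonzero. Consequently,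 for every parallel force diagram $q$ there are no new positions $q':F\to\mathbb R^2$ with $(d^*q')_e-(d^*q)_e-(du)_e\in\mathbb R(dp)_e$ for all $e$ (axial extension of the dual edges being free). Likewise in terms of angular velocities: writing $(d^*q)_e=w_e(dp)_e$ and $(du)_e=\omega_e J(dp)_e$, if $w_e\omega_e\neq0$ for some $e$, then there are no velocities $\eta:F\to\mathbb R^2$ of the dual vertices with $(d^*\eta)_e-\operatorname{sgn}(w_e)\,\omega_e\,J(d^*q)_e\in\mathbb R(dp)_e$ for all $e$ (dual edges turn at the rate of the edges, flipped according to the sign of the stress $w_e$, and may change length). -/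

import Mathlib

noncomputable section

namespace GraphicStatics

/-- The Euclidean plane `ℝ²`. -/
abbrev Plane : Type := EuclideanSpace ℝ (Fin 2)

/-- The quarter turn `(x, y) ↦ (-y, x)` of the plane. -/
def quarterTurn (x : Plane) : Plane := !₂[-(x 1), x 0]

/-! ### Cell decompositions of the sphere -/

/-- The darts (oriented edges) over an edge set `E`: every edge `e` carries an arbitrary reference
orientation, `(e, true)` is `e` with that orientation and `(e, false)` is `e` reversed. -/
abbrev Dart (E : Type*) : Type _ := E × Bool

/-- The reversed dart. -/
abbrev Dart.rev {E : Type*} (d : Dart E) : Dart E := (d.1, !d.2)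

/-- A finite cell decomposition `X = (V, E, F)` of the sphere, as a connected combinatorial map
of genus zero. -/
structure SphericalComplex (V E F : Type*) [Fintype V] [Fintype E] [Fintype F] where
  /-- the vertex at which a dart starts -/
  tail : Dart E → V
  /-- the face on the left of a dart -/
  left : Dart E → F
  /-- the next dart, counterclockwise, among those with the same tail -/
  rot : Equiv.Perm (Dart E)
  /-- the next dart along the boundary walk of the face on the left -/
  next : Equiv.Perm (Dart E)
  /-- at its head, the boundary walk continues with the first dart clockwise from the reversal -/
  rot_next : ∀ d, rot (next d) = d.rev
  /-- the darts at a vertex form one cycle of the rotation -/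
  tail_eq_iff : ∀ d d', tail d = tail d' ↔ rot.SameCycle d d'
  /-- the darts around a face form one cyclic boundary walk -/
  left_eq_iff : ∀ d d', left d = left d' ↔ next.SameCycle d d'
  tail_surjective : Function.Surjective tail
  left_surjective : Function.Surjective left
  /-- the graph `(V, E)` is connected -/
  connected : ∀ v w : V,
    Relation.ReflTransGen (fun a b => ∃ d : Dart E, tail d = a ∧ tail d.rev = b) v w
  /-- the genus is zero -/
  euler : Fintype.card V + Fintype.card F = Fintype.card E + 2

section Cosheaves

variable {V E F : Type*} [Fintype V] [Fintype E] [Fintype F]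

/-! ### Cellular cosheaves and their homology -/

/-- A cellular cosheaf of finite dimensional real vector spaces on `X`. An incidence of a face `f`
with an edge is a dart with `f` on its left; an incidence of an edge with a vertex `v` is a dart
with tail `v`. -/
structure Cosheaf (X : SphericalComplex V E F) where
  vStalk : V → Type
  eStalk : E → Type
  fStalk : F → Type
  [vGroup : ∀ v, AddCommGroup (vStalk v)]
  [eGroup : ∀ e, AddCommGroup (eStalk e)]
  [fGroup : ∀ f, AddCommGroup (fStalk f)]
  [vModule : ∀ v, Module ℝ (vStalk v)]
  [eModule : ∀ e, Module ℝ (eStalk e)]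
  [fModule : ∀ f, Module ℝ (fStalk f)]
  [vFinite : ∀ v, Module.Finite ℝ (vStalk v)]
  [eFinite : ∀ e, Module.Finite ℝ (eStalk e)]
  [fFinite : ∀ f, Module.Finite ℝ (fStalk f)]
  /-- from edges to vertices -/
  toV : ∀ (d : Dart E) (v : V), X.tail d = v → eStalk d.1 →ₗ[ℝ] vStalk v
  /-- from faces to edges -/
  toE : ∀ (d : Dart E) (f : F), X.left d = f → fStalk f →ₗ[ℝ] eStalk d.1
  /-- at each corner `v` of a face `f`, the two composites from `f` to `v` agree -/
  comp_eq : ∀ (d : Dart E) (f : F) (v : V) (hf : X.left d = f) (hf' : X.left (X.next d) = f)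
    (hv : X.tail d.rev = v) (hv' : X.tail (X.next d) = v),
    toV d.rev v hv ∘ₗ toE d f hf = toV (X.next d) v hv' ∘ₗ toE (X.next d) f hf'

attribute [instance] Cosheaf.vGroup Cosheaf.eGroup Cosheaf.fGroup Cosheaf.vModule
  Cosheaf.eModule Cosheaf.fModule Cosheaf.vFinite Cosheaf.eFinite Cosheaf.fFinite

namespace Cosheaf

variable {X : SphericalComplex V E F}

/-- 0-chains. -/
abbrev C0 (K : Cosheaf X) : Type _ := ∀ v, K.vStalk v

/-- 1-chains. -/
abbrev C1 (K : Cosheaf X) : Type _ := ∀ e, K.eStalk e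

/-- 2-chains. -/
abbrev C2 (K : Cosheaf X) : Type _ := ∀ f, K.fStalk f

/-- The sign of an edge in the boundary at the end of the edge given by a dart starting there:
`+1` at the head of the reference orientation, `-1` at its tail. -/
def endSign (d : Dart E) : ℝ := if d.2 then -1 else 1

open Classical in
/-- The boundary map from 1-chains to 0-chains. -/
def d1 (K : Cosheaf X) : K.C1 →ₗ[ℝ] K.C0 :=
  LinearMap.pi fun v => ∑ d : {d : Dart E // X.tail d = v},
    endSign d.1 • (K.toV d.1 v d.2 ∘ₗ LinearMap.proj d.1.1)

/-- The boundary map from 2-chains to 1-chains: the boundary of a face is traversed with the face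
on the left. -/
def d2 (K : Cosheaf X) : K.C2 →ₗ[ℝ] K.C1 :=
  LinearMap.pi fun e =>
    K.toE (e, true) _ rfl ∘ₗ LinearMap.proj (X.left (e, true)) -
      K.toE (e, false) _ rfl ∘ₗ LinearMap.proj (X.left (e, false))

/-- `H₀ = C₀ / im ∂₁`. -/
abbrev H0 (K : Cosheaf X) : Type _ := K.C0 ⧸ LinearMap.range K.d1

/-- `H₁ = ker ∂₁ / im ∂₂`. -/
abbrev H1 (K : Cosheaf X) : Type _ :=
  LinearMap.ker K.d1 ⧸ (LinearMap.range K.d2).comap (LinearMap.ker K.d1).subtype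

/-- `H₂ = ker ∂₂`. -/
abbrev H2 (K : Cosheaf X) : Submodule ℝ K.C2 := LinearMap.ker K.d2

/-- Maps of cosheaves. -/
structure Hom (K L : Cosheaf X) where
  v : ∀ v, K.vStalk v →ₗ[ℝ] L.vStalk v
  e : ∀ e, K.eStalk e →ₗ[ℝ] L.eStalk e
  f : ∀ f, K.fStalk f →ₗ[ℝ] L.fStalk f
  comm_v : ∀ (d : Dart E) (w : V) (h : X.tail d = w),
    v w ∘ₗ K.toV d w h = L.toV d w h ∘ₗ e d.1
  comm_e : ∀ (d : Dart E) (g : F) (h : X.left d = g),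
    e d.1 ∘ₗ K.toE d g h = L.toE d g h ∘ₗ f g

namespace Hom

variable {K L : Cosheaf X}

/-- The map on 0-chains. -/
def c0 (φ : Hom K L) : K.C0 →ₗ[ℝ] L.C0 :=
  LinearMap.pi fun v => φ.v v ∘ₗ LinearMap.proj v

/-- The map on 1-chains. -/
def c1 (φ : Hom K L) : K.C1 →ₗ[ℝ] L.C1 :=
  LinearMap.pi fun e => φ.e e ∘ₗ LinearMap.proj e

/-- The map on 2-chains. -/
def c2 (φ : Hom K L) : K.C2 →ₗ[ℝ] L.C2 :=
  LinearMap.pi fun f => φ.f f ∘ₗ LinearMap.proj f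

theorem c0_d1 (φ : Hom K L) (x : K.C1) : φ.c0 (K.d1 x) = L.d1 (φ.c1 x) := by
  funext v
  simp only [c0, c1, d1, LinearMap.pi_apply, LinearMap.comp_apply, LinearMap.proj_apply,
    LinearMap.sum_apply, LinearMap.smul_apply, map_sum, map_smul]
  refine Finset.sum_congr rfl fun d _ => ?_
  exact congrArg _ (LinearMap.congr_fun (φ.comm_v d.1 v d.2) (x d.1.1))

/-- The map on `H₀`. -/
def h0 (φ : Hom K L) : K.H0 →ₗ[ℝ] L.H0 :=
  Submodule.mapQ _ _ φ.c0 (by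
    rintro _ ⟨x, rfl⟩
    exact ⟨φ.c1 x, (φ.c0_d1 x).symm⟩)

end Hom

/-- The quotient cosheaf `L / K` along a map `φ : K → L` (an inclusion, in all uses). -/
abbrev quotient {K L : Cosheaf X} (φ : Hom K L) : Cosheaf X where
  vStalk v := L.vStalk v ⧸ LinearMap.range (φ.v v)
  eStalk e := L.eStalk e ⧸ LinearMap.range (φ.e e)
  fStalk f := L.fStalk f ⧸ LinearMap.range (φ.f f)
  toV d v h := Submodule.mapQ _ _ (L.toV d v h) (by
    rintro _ ⟨x, rfl⟩
    exact ⟨K.toV d v h x, LinearMap.congr_fun (φ.comm_v d v h) x⟩)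
  toE d f h := Submodule.mapQ _ _ (L.toE d f h) (by
    rintro _ ⟨x, rfl⟩
    exact ⟨K.toE d f h x, LinearMap.congr_fun (φ.comm_e d f h) x⟩)
  comp_eq d f v hf hf' hv hv' := by
    refine LinearMap.ext fun x => ?_
    obtain ⟨x, rfl⟩ := Submodule.Quotient.mk_surjective _ x
    exact congrArg (Submodule.Quotient.mk (p := LinearMap.range (φ.v v)))
      (LinearMap.congr_fun (L.comp_eq d f v hf hf' hv hv') x)

/-- The projection onto the quotient cosheaf. -/
def quotientMap {K L : Cosheaf X} (φ : Hom K L) : Hom L (quotient φ) where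
  v v := (LinearMap.range (φ.v v)).mkQ
  e e := (LinearMap.range (φ.e e)).mkQ
  f f := (LinearMap.range (φ.f f)).mkQ
  comm_v _ _ _ := rfl
  comm_e _ _ _ := rfl

/-- The constant cosheaf: every stalk is `W` and every map is the identity. -/
abbrev const (X : SphericalComplex V E F) (W : Type) [AddCommGroup W] [Module ℝ W]
    [Module.Finite ℝ W] : Cosheaf X where
  vStalk _ := W
  eStalk _ := W
  fStalk _ := W
  toV _ _ _ := LinearMap.id
  toE _ _ _ := LinearMap.id
  comp_eq _ _ _ _ _ _ _ := rfl

end Cosheaf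

end Cosheaves

/-! ### Form diagrams -/

/-- A form diagram: a cell decomposition of the sphere together with a realization
`p : V → ℝ²` of its vertices for which every edge is a nondegenerate straight segment. -/
structure FormDiagram (V E F : Type*) [Fintype V] [Fintype E] [Fintype F] extends
    SphericalComplex V E F where
  p : V → Plane
  p_ne : ∀ e : E, p (tail (e, true)) ≠ p (tail (e, false))

namespace FormDiagram

variable {V E F : Type*} [Fintype V] [Fintype E] [Fintype F] (X : FormDiagram V E F)

/-- The difference (head minus tail) across the edge `e` of an assignment of vectors to the
vertices. -/
def diff : (V → Plane) →ₗ[ℝ] (E → Plane) :=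
  LinearMap.funLeft ℝ Plane (fun e => X.tail (e, false)) -
    LinearMap.funLeft ℝ Plane (fun e => X.tail (e, true))

/-- The dual edge (left minus right) of `e` for an assignment of positions to the faces, that is,
to the dual vertices. -/
def dualDiff (q : F → Plane) (e : E) : Plane := q (X.left (e, true)) - q (X.left (e, false))

/-- The edge `e` as a vector. -/
abbrev edgeVec (e : E) : Plane := X.diff X.p e

/-- The force cosheaf: vertex stalks `ℝ²`, edge stalks `ℝ`, face stalks `0`. A unit stress in the
edge `uv` contributes `p u - p v` at `u` and `p v - p u` at `v` to the boundary: the map from the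
edge to either end is multiplication by the edge vector, the sign comes from the orientation. -/
abbrev force : Cosheaf X.toSphericalComplex where
  vStalk _ := Plane
  eStalk _ := ℝ
  fStalk _ := PUnit
  toV d _ _ := LinearMap.toSpanSingleton ℝ Plane (X.edgeVec d.1)
  toE _ _ _ := 0
  comp_eq _ _ _ _ _ _ _ := by simp

/-- The constant cosheaf with stalk `ℝ²`. -/
abbrev ambient : Cosheaf X.toSphericalComplex := Cosheaf.const X.toSphericalComplex Plane

/-- The inclusion of the force cosheaf in the constant cosheaf. -/
def inclusion : Cosheaf.Hom X.force X.ambient where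
  v _ := (LinearMap.id : Plane →ₗ[ℝ] Plane)
  e e := LinearMap.toSpanSingleton ℝ Plane (X.edgeVec e)
  f _ := (0 : PUnit →ₗ[ℝ] Plane)
  comm_v _ _ _ := rfl
  comm_e _ _ _ := by
    refine LinearMap.ext fun _ => ?_
    exact LinearMap.map_zero _

/-- The position cosheaf, the quotient of the constant cosheaf by the force cosheaf. -/
abbrev position : Cosheaf X.toSphericalComplex := Cosheaf.quotient X.inclusion

/-- The projection of the constant cosheaf onto the position cosheaf. -/
def projection : Cosheaf.Hom X.ambient X.position := Cosheaf.quotientMap X.inclusion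

/-- The vertex stalks of the position cosheaf vanish, so every 1-chain is a cycle. -/
theorem position_d1 (x : X.position.C1) : X.position.d1 x = 0 := by
  funext v
  have h : LinearMap.range (X.inclusion.v v) = ⊤ := LinearMap.range_id
  obtain ⟨y, hy⟩ := Submodule.Quotient.mk_surjective _ (X.position.d1 x v)
  exact hy.symm.trans ((Submodule.Quotient.mk_eq_zero _).2 (h ▸ Submodule.mem_top))

/-- The class in `H₁` of a 1-chain of the position cosheaf. -/
def positionClass : X.position.C1 →ₗ[ℝ] X.position.H1 :=
  Submodule.mkQ _ ∘ₗ LinearMap.codRestrict _ LinearMap.id X.position_d1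

/-- The infinitesimal motions of the truss: velocities of the vertices that preserve, to first
order, the lengths of all edges. -/
def motions : Submodule ℝ (V → Plane) where
  carrier := {u | ∀ e, inner ℝ (X.edgeVec e) (X.diff u e) = 0}
  zero_mem' e := by simp
  add_mem' {u w} hu hw e := by
    rw [map_add, Pi.add_apply, inner_add_right, hu e, hw e, add_zero]
  smul_mem' c u hu e := by
    rw [map_smul, Pi.smul_apply, inner_smul_right, hu e, mul_zero]

/-- Global translations. -/
def IsTranslation (u : V → Plane) : Prop := ∃ t : Plane, ∀ v, u v = t

/-- Global (infinitesimal) rotations, with nonzero angular velocity `a` about a center `c`. -/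
def IsGlobalRotation (u : V → Plane) : Prop :=
  ∃ (a : ℝ) (c : Plane), a ≠ 0 ∧ ∀ v, u v = a • quarterTurn (X.p v - c)

/-- Mechanisms: infinitesimal motions that are not induced by a rigid motion of the plane. -/
def IsMechanism (u : V → Plane) : Prop :=
  u ∈ X.motions ∧ ¬ ∃ (a : ℝ) (t : Plane), ∀ v, u v = a • quarterTurn (X.p v) + t

/-- The degree of freedom in `H₀` of the force cosheaf that is represented by vectors at the
vertices. -/
def dof : (V → Plane) →ₗ[ℝ] X.force.H0 := Submodule.mkQ (LinearMap.range X.force.d1)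

/-- The edge rotations induced by velocities `u` of the vertices: the relative velocity of the two
ends of each edge, modulo the direction of the edge. -/
def edgeRotation : (V → Plane) →ₗ[ℝ] X.position.C1 := X.projection.c1 ∘ₗ X.diff

/-- Parallel realizations of the dual complex (force diagrams): positions of the dual vertices that
represent an element of `H₂` of the position cosheaf. -/
def IsForceDiagram (q : F → Plane) : Prop := X.projection.c2 q ∈ X.position.H2

end FormDiagram

end GraphicStatics

end

noncomputable section

namespace GraphicStatics

/-! ### The orthogonal decomposition of plane vector fields on a finite set -/

/-! Everything rests on two adjunctions. The boundary `∂₁` of the constant cosheaf is adjoint to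
`d`, so its image is the orthogonal complement of the constant fields, that is, the fields with
vertex sum zero. For the force cosheaf, `∂₁` is the transposed rigidity matrix, so the orthogonal
complement of its image is the space of infinitesimal motions; hence each class in `H₀ F` has
exactly one motion in it (`dof_motions_bijective`).

Summation around the faces gives `∑ ⟨d*q, du⟩ = 0` (`sum_inner_dualDiff_diff`), so `∂₁ d* = 0`;
Euler's relation turns this into exactness at 1-chains of the constant cosheaf
(`exists_dualDiff_eq`). Therefore `∂₁ x` is a boundary of stresses exactly when `x` has zero class
in `H₁ G`, which makes the connecting map both well defined and injective.

If `u` is a motion and `du = d*q + t dp`, pairing with `du` gives `∑ |du|² = 0`, so `u` is a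
translation. This is the obstruction for mechanisms and rotations, and it survives nonnegative
weights on the edges (`smul_diff_eq_zero_of_dualDiff`), as needed for angular velocities. A
dimension count then shows that edge rotations of motions fill `H₁ G`. -/

theorem exists_orthogonal_decomposition {ι : Type*} [Fintype ι] (R : Submodule ℝ (ι → Plane))
    (c : ι → Plane) :
    ∃ r ∈ R, ∃ u : ι → Plane, (∀ r' ∈ R, ∑ i, inner ℝ (u i) (r' i) = 0) ∧ c = r + u := by
  -- The orthogonal projection is taken in the `ℓ²` product, whose inner product is the sum of the
  -- pointwise ones.
  let L : PiLp 2 (fun _ : ι => Plane) ≃ₗ[ℝ] (ι → Plane) := WithLp.linearEquiv 2 ℝ (ι → Plane)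
  obtain ⟨y, hy, z, hz, hyz⟩ :=
    (R.comap L.toLinearMap).exists_add_mem_mem_orthogonal (L.symm c)
  refine ⟨L y, hy, L z, fun r' hr' => ?_, ?_⟩
  · have h := (Submodule.mem_orthogonal' _ _).1 hz (L.symm r') (by simpa using hr')
    rw [PiLp.inner_apply] at h
    exact h
  · rw [← map_add, ← hyz, LinearEquiv.apply_symm_apply]

theorem eq_zero_of_sum_inner_self {ι : Type*} [Fintype ι] {u : ι → Plane}
    (h : ∑ i, inner ℝ (u i) (u i) = 0) : u = 0 := by
  funext i
  have h' := (Finset.sum_eq_zero_iff_of_nonneg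
    (fun i _ => real_inner_self_nonneg (x := u i))).1 h i (Finset.mem_univ i)
  exact inner_self_eq_zero.1 h'

/-- The component of `c` orthogonal to `R` is itself a test vector, and its pairing with `c` is its
own square norm. -/
theorem mem_of_forall_orthogonal {ι : Type*} [Fintype ι] (R : Submodule ℝ (ι → Plane))
    (c : ι → Plane)
    (h : ∀ u : ι → Plane, (∀ r ∈ R, ∑ i, inner ℝ (u i) (r i) = 0) →
      ∑ i, inner ℝ (u i) (c i) = 0) : c ∈ R := by
  obtain ⟨r, hr, u, hu, rfl⟩ := exists_orthogonal_decomposition R c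
  have h1 := h u hu
  simp only [Pi.add_apply, inner_add_right, Finset.sum_add_distrib, hu r hr, zero_add] at h1
  rwa [eq_zero_of_sum_inner_self h1, add_zero]

/-! ### The quarter turn -/

theorem inner_quarterTurn (x y : Plane) : inner ℝ x (quarterTurn y) = x 1 * y 0 - x 0 * y 1 := by
  simp [quarterTurn, PiLp.inner_apply, Fin.sum_univ_two]
  ring

theorem quarterTurn_smul (a : ℝ) (x : Plane) : quarterTurn (a • x) = a • quarterTurn x := by
  ext i; fin_cases i <;> simp [quarterTurn]

theorem quarterTurn_sub (x y : Plane) : quarterTurn (x - y) = quarterTurn x - quarterTurn y := by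
  ext i; fin_cases i <;> simp [quarterTurn]; ring

theorem quarterTurn_ne_zero {x : Plane} (hx : x ≠ 0) : quarterTurn x ≠ 0 := by
  intro h
  apply hx
  have h0 := congrArg (fun y : Plane => y 0) h
  have h1 := congrArg (fun y : Plane => y 1) h
  ext i; fin_cases i <;> simp_all [quarterTurn]

theorem exists_eq_smul_quarterTurn {x y : Plane} (hx : x ≠ 0) (h : inner ℝ x y = 0) :
    ∃ a : ℝ, y = a • quarterTurn x := by
  have hn : x 0 ^ 2 + x 1 ^ 2 ≠ 0 := by
    intro h0
    apply hx
    ext i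
    fin_cases i
    · show x 0 = 0
      nlinarith [sq_nonneg (x 0), sq_nonneg (x 1)]
    · show x 1 = 0
      nlinarith [sq_nonneg (x 0), sq_nonneg (x 1)]
  have h' : x 0 * y 0 + x 1 * y 1 = 0 := by
    simpa [PiLp.inner_apply, Fin.sum_univ_two, mul_comm] using h
  -- The coefficient is `⟨Jx, y⟩ / |x|²`.
  refine ⟨(x 0 * y 1 - x 1 * y 0) / (x 0 ^ 2 + x 1 ^ 2), ?_⟩
  ext i
  fin_cases i
  · simp only [quarterTurn, Fin.zero_eta, PiLp.smul_apply, smul_eq_mul]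
    simp
    field_simp
    linear_combination (x 0) * h'
  · simp only [quarterTurn, Fin.mk_one, PiLp.smul_apply, smul_eq_mul]
    simp
    field_simp
    linear_combination (x 1) * h'

/-! ### Connectivity -/

namespace SphericalComplex

variable {V E F : Type*} [Fintype V] [Fintype E] [Fintype F] (X : SphericalComplex V E F)

theorem tail_rot (d : Dart E) : X.tail (X.rot d) = X.tail d :=
  (X.tail_eq_iff _ _).2 (Equiv.Perm.sameCycle_apply_left.2 (Equiv.Perm.SameCycle.refl _ _))

theorem left_next (d : Dart E) : X.left (X.next d) = X.left d :=
  (X.left_eq_iff _ _).2 (Equiv.Perm.sameCycle_apply_left.2 (Equiv.Perm.SameCycle.refl _ _))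

theorem tail_next (d : Dart E) : X.tail (X.next d) = X.tail d.rev := by
  rw [← X.rot_next d, X.tail_rot]

/-- Without darts there are no vertices or faces, and Euler's relation would read `0 = 2`. -/
theorem nonempty_edges (X : SphericalComplex V E F) : Nonempty E := by
  by_contra h
  rw [not_nonempty_iff] at h
  have hV : IsEmpty V := ⟨fun v => (X.tail_surjective v).elim fun d _ => h.elim d.1⟩
  have hF : IsEmpty F := ⟨fun f => (X.left_surjective f).elim fun d _ => h.elim d.1⟩
  have := X.euler
  simp at this

theorem nonempty_vertices (X : SphericalComplex V E F) : Nonempty V :=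
  X.nonempty_edges.map fun e => X.tail (e, true)

theorem nonempty_faces (X : SphericalComplex V E F) : Nonempty F :=
  X.nonempty_edges.map fun e => X.left (e, true)

/-- The fibers of `tail` are the cycles of the rotation, so a rotation-invariant function of darts
descends to the vertices. -/
theorem eq_of_tail_eq {α : Type*} {g : Dart E → α} (hg : ∀ d, g (X.rot d) = g d) {d d' : Dart E}
    (h : X.tail d = X.tail d') : g d = g d' := by
  obtain ⟨n, rfl⟩ := (X.tail_eq_iff _ _).1 h
  have key : ∀ n : ℕ, ∀ d, g ((X.rot ^ n) d) = g d := by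
    intro n
    induction n with
    | zero => simp
    | succ k ih => intro d; rw [pow_succ', Equiv.Perm.mul_apply, hg, ih]
  cases n with
  | ofNat n => exact (key n d).symm
  | negSucc n =>
    rw [zpow_negSucc]
    conv_lhs => rw [← (X.rot ^ (n + 1)).apply_symm_apply d]
    exact key _ _

theorem vertex_function_constant {α : Type*} {u : V → α}
    (hu : ∀ e, u (X.tail (e, false)) = u (X.tail (e, true))) (v w : V) : u v = u w := by
  induction X.connected v w with
  | refl => rfl
  | tail _ h ih =>
    obtain ⟨⟨e, b⟩, rfl, rfl⟩ := h
    cases b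
    · exact ih.trans (hu e)
    · exact ih.trans (hu e).symm

/-- The dual graph is connected. -/
theorem face_function_constant {α : Type*} {q : F → α}
    (hq : ∀ e, q (X.left (e, true)) = q (X.left (e, false))) (f g : F) : q f = q g := by
  have hrev : ∀ d : Dart E, q (X.left d.rev) = q (X.left d) := by
    rintro ⟨e, b⟩
    cases b
    · exact hq e
    · exact (hq e).symm
  -- Turning about a vertex only crosses edges, so `q` takes one value on all faces around it. The
  -- resulting function of vertices agrees at the two ends of every edge, and connectivity of the
  -- primal graph applies.
  have hrot : ∀ d : Dart E, q (X.left (X.rot d)) = q (X.left d) := by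
    intro d
    obtain ⟨d, rfl⟩ := X.next.surjective d
    rw [X.rot_next, hrev, X.left_next]
  have htail : ∀ {d d' : Dart E}, X.tail d = X.tail d' → q (X.left d) = q (X.left d') :=
    fun h => X.eq_of_tail_eq (g := fun d => q (X.left d)) hrot h
  obtain ⟨d, rfl⟩ := X.left_surjective f
  obtain ⟨d', rfl⟩ := X.left_surjective g
  have := X.vertex_function_constant
    (u := fun v => q (X.left (Function.surjInv X.tail_surjective v))) (by
      intro e
      have h1 : q (X.left (Function.surjInv X.tail_surjective (X.tail (e, false)))) =
        q (X.left (e, false)) := htail (Function.surjInv_eq X.tail_surjective _)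
      have h2 : q (X.left (Function.surjInv X.tail_surjective (X.tail (e, true)))) =
        q (X.left (e, true)) := htail (Function.surjInv_eq X.tail_surjective _)
      exact h1.trans ((hq e).symm.trans h2.symm)) (X.tail d) (X.tail d')
  exact (htail (Function.surjInv_eq X.tail_surjective _)).symm.trans
    (this.trans (htail (Function.surjInv_eq X.tail_surjective _)))

theorem sum_tail_fibers {M : Type*} [AddCommMonoid M] [∀ v, Fintype {d : Dart E // X.tail d = v}]
    (f : Dart E → M) : ∑ v, ∑ d : {d : Dart E // X.tail d = v}, f d.1 = ∑ d, f d := by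
  rw [← Fintype.sum_sigma']
  exact Fintype.sum_equiv (Equiv.sigmaFiberEquiv X.tail) _ _ fun _ => rfl

theorem sum_darts {M : Type*} [AddCommMonoid M] (f : Dart E → M) :
    ∑ d, f d = ∑ e, (f (e, true) + f (e, false)) := by
  rw [Fintype.sum_prod_type]
  simp

end SphericalComplex

/-! ### Chains and velocities -/

namespace FormDiagram

variable {V E F : Type*} [Fintype V] [Fintype E] [Fintype F] (X : FormDiagram V E F)

theorem diff_apply (u : V → Plane) (e : E) :
    X.diff u e = u (X.tail (e, false)) - u (X.tail (e, true)) := rfl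

theorem edgeVec_ne_zero (e : E) : X.edgeVec e ≠ 0 :=
  sub_ne_zero.2 (X.p_ne e).symm

theorem isTranslation_iff_diff_eq_zero (u : V → Plane) : IsTranslation u ↔ X.diff u = 0 := by
  constructor
  · rintro ⟨t, ht⟩
    funext e
    simp [diff_apply, ht]
  · intro h
    obtain ⟨v⟩ := X.nonempty_vertices
    exact ⟨u v, fun w => X.vertex_function_constant
      (fun e => sub_eq_zero.1 (congrFun h e)) w v⟩

/-- The boundary of the constant cosheaf is adjoint to the difference. -/
theorem sum_inner_ambient_d1 (u : V → Plane) (x : E → Plane) :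
    ∑ v, inner ℝ (u v) (X.ambient.d1 x v) = ∑ e, inner ℝ (x e) (X.diff u e) := by
  classical
  have h : ∀ v, inner ℝ (u v) (X.ambient.d1 x v) = ∑ d : {d : Dart E // X.tail d = v},
      (fun d : Dart E => Cosheaf.endSign d * inner ℝ (x d.1) (u (X.tail d))) d.1 := by
    intro v
    have h' : X.ambient.d1 x v =
        ∑ d : {d : Dart E // X.tail d = v}, Cosheaf.endSign d.1 • x d.1.1 := by
      simp only [Cosheaf.d1, LinearMap.pi_apply, LinearMap.sum_apply, LinearMap.smul_apply]
      refine Finset.sum_congr ?_ fun d _ => rfl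
      ext; simp
    rw [h', inner_sum]
    refine Finset.sum_congr rfl fun d _ => ?_
    simp only [inner_smul_right, d.2]
    rw [real_inner_comm]
  rw [Finset.sum_congr rfl fun v _ => h v]
  refine (X.sum_tail_fibers
    fun d => Cosheaf.endSign d * inner ℝ (x d.1) (u (X.tail d))).trans ?_
  rw [SphericalComplex.sum_darts]
  refine Finset.sum_congr rfl fun e _ => ?_
  simp only [Cosheaf.endSign, diff_apply, inner_sub_right]
  simp
  ring

theorem force_d1 (y : E → ℝ) :
    X.force.d1 y = X.ambient.d1 (fun e => y e • X.edgeVec e) :=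
  X.inclusion.c0_d1 y

theorem sum_inner_force_d1 (u : V → Plane) (y : E → ℝ) :
    ∑ v, inner ℝ (u v) (X.force.d1 y v) = ∑ e, y e * inner ℝ (X.edgeVec e) (X.diff u e) := by
  rw [force_d1, sum_inner_ambient_d1]
  simp [inner_smul_left]

/-- Dual differences are orthogonal to differences. -/
theorem sum_inner_dualDiff_diff (q : F → Plane) (u : V → Plane) :
    ∑ e, inner ℝ (X.dualDiff q e) (X.diff u e) = 0 := by
  have h : ∑ d : Dart E, inner ℝ (q (X.left d)) (u (X.tail d.rev)) =
      ∑ d : Dart E, inner ℝ (q (X.left d)) (u (X.tail d)) := by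
    -- Reindexing by `next` keeps the left face and moves the tail of a dart to its head. Grouping
    -- the two darts of each edge then yields `⟨d*q, du⟩`.
    rw [← Equiv.sum_comp X.next fun d => inner ℝ (q (X.left d)) (u (X.tail d))]
    simp_rw [X.left_next, X.tail_next]
  rw [SphericalComplex.sum_darts, SphericalComplex.sum_darts, ← sub_eq_zero,
    ← Finset.sum_sub_distrib] at h
  rw [← h]
  refine Finset.sum_congr rfl fun e _ => ?_
  simp only [dualDiff, diff_apply, inner_sub_left, inner_sub_right, Dart.rev, Bool.not_true,
    Bool.not_false]
  ring

/-! ### Exactness of the chain complex of the constant cosheaf -/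

theorem ambient_d1_dualDiff (q : F → Plane) : X.ambient.d1 (X.dualDiff q) = 0 :=
  eq_zero_of_sum_inner_self (by rw [sum_inner_ambient_d1, sum_inner_dualDiff_diff])

theorem sum_ambient_d1 (x : E → Plane) : ∑ v, X.ambient.d1 x v = (0 : Plane) := by
  refine ext_inner_left ℝ fun t => ?_
  rw [inner_sum, inner_zero_right, X.sum_inner_ambient_d1 (fun _ => t) x]
  simp [diff_apply]

/-- The sum of a field of vectors over the vertices. -/
def vertexSum (V : Type*) [Fintype V] : (V → Plane) →ₗ[ℝ] Plane :=
  ∑ v, LinearMap.proj v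

theorem vertexSum_apply (c : V → Plane) : vertexSum V c = ∑ v, c v := by
  simp [vertexSum]

theorem range_ambient_d1 : LinearMap.range X.ambient.d1 = LinearMap.ker (vertexSum V) := by
  refine le_antisymm ?_ fun c hc => ?_
  · rintro _ ⟨x, rfl⟩
    exact (vertexSum_apply _).trans (X.sum_ambient_d1 x)
  · refine mem_of_forall_orthogonal _ _ fun u hu => ?_
    -- The field `u` is tested against the boundary of its own difference `du`, which gives `∑ |du|²
    -- = 0`.
    have hu' : X.diff u = 0 := eq_zero_of_sum_inner_self (by
      rw [← X.sum_inner_ambient_d1 u (X.diff u)]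
      exact hu _ ⟨X.diff u, rfl⟩)
    obtain ⟨t, ht⟩ := (X.isTranslation_iff_diff_eq_zero u).2 hu'
    simp_rw [ht]
    rw [← inner_sum, ← vertexSum_apply, LinearMap.mem_ker.1 hc, inner_zero_right]

theorem vertexSum_surjective [Nonempty V] : Function.Surjective (vertexSum V) := by
  classical
  intro t
  obtain ⟨v⟩ := ‹Nonempty V›
  exact ⟨Pi.single v t, by simp [vertexSum_apply]⟩

theorem finrank_range_ambient_d1 :
    Module.finrank ℝ (LinearMap.range X.ambient.d1) + 2 = 2 * Fintype.card V := by
  have := X.nonempty_vertices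
  have h := LinearMap.finrank_range_add_finrank_ker (vertexSum V)
  rw [LinearMap.range_eq_top.2 vertexSum_surjective, finrank_top] at h
  rw [range_ambient_d1, add_comm]
  simpa [Module.finrank_pi_fintype, mul_comm] using h

theorem finrank_ker_ambient_d2 : Module.finrank ℝ (LinearMap.ker X.ambient.d2) = 2 := by
  have := X.nonempty_faces
  let c : Plane →ₗ[ℝ] (F → Plane) := LinearMap.pi fun _ => LinearMap.id
  have hc : LinearMap.ker X.ambient.d2 = LinearMap.range c := by
    ext q
    constructor
    · intro hq
      obtain ⟨f⟩ := X.nonempty_faces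
      refine ⟨q f, funext fun g => X.face_function_constant (fun e => ?_) f g⟩
      exact sub_eq_zero.1 (congrFun (LinearMap.mem_ker.1 hq) e)
    · rintro ⟨t, rfl⟩
      exact LinearMap.mem_ker.2 (funext fun e => sub_self t)
  rw [hc, LinearMap.finrank_range_of_inj]
  · simp
  · intro a b h
    exact congrFun h (Classical.arbitrary F)

/-- The first homology of the constant cosheaf vanishes. -/
theorem exists_dualDiff_eq {x : E → Plane} (hx : X.ambient.d1 x = 0) :
    ∃ q, X.dualDiff q = x := by
  have hle : LinearMap.range X.ambient.d2 ≤ LinearMap.ker X.ambient.d1 := by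
    rintro _ ⟨q, rfl⟩
    exact X.ambient_d1_dualDiff q
  have h1 : Module.finrank ℝ (LinearMap.range X.ambient.d1) +
      Module.finrank ℝ (LinearMap.ker X.ambient.d1) = Module.finrank ℝ (E → Plane) :=
    LinearMap.finrank_range_add_finrank_ker X.ambient.d1
  have h2 : Module.finrank ℝ (LinearMap.range X.ambient.d2) +
      Module.finrank ℝ (LinearMap.ker X.ambient.d2) = Module.finrank ℝ (F → Plane) :=
    LinearMap.finrank_range_add_finrank_ker X.ambient.d2
  have h3 := X.finrank_range_ambient_d1
  have h4 := X.finrank_ker_ambient_d2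
  have h5 := X.euler
  simp only [Module.finrank_pi_fintype, finrank_euclideanSpace, Fintype.card_fin,
    Finset.sum_const, Finset.card_univ, smul_eq_mul] at h1 h2
  -- The kernel of `∂₁` has dimension `2|E| - 2|V| + 2` and the image of `∂₂` has dimension `2|F| -
  -- 2`; these agree by Euler's relation.
  have heq := Submodule.eq_of_le_of_finrank_eq hle (by omega)
  have hx' : x ∈ LinearMap.range X.ambient.d2 := heq ▸ LinearMap.mem_ker.2 hx
  exact hx'

/-! ### Homology classes of the position cosheaf -/

theorem projection_c1_surjective : Function.Surjective X.projection.c1 := by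
  intro z
  choose x hx using fun e => Submodule.Quotient.mk_surjective _ (z e)
  exact ⟨x, funext hx⟩

theorem projection_c2_surjective : Function.Surjective X.projection.c2 := by
  intro z
  choose x hx using fun f => Submodule.Quotient.mk_surjective _ (z f)
  exact ⟨x, funext hx⟩

theorem positionClass_surjective : Function.Surjective X.positionClass := by
  intro h
  obtain ⟨⟨z, hz⟩, rfl⟩ := Submodule.Quotient.mk_surjective _ h
  exact ⟨z, rfl⟩

theorem positionClass_eq_zero_iff (z : X.position.C1) :
    X.positionClass z = 0 ↔ ∃ y, X.position.d2 y = z :=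
  Submodule.Quotient.mk_eq_zero _

theorem projection_c1_eq_zero_iff (x : E → Plane) :
    X.projection.c1 x = 0 ↔ ∃ t : E → ℝ, ∀ e, t e • X.edgeVec e = x e := by
  constructor
  · intro h
    have h' : ∀ e, ∃ t : ℝ, t • X.edgeVec e = x e := fun e =>
      (Submodule.Quotient.mk_eq_zero (LinearMap.range (X.inclusion.e e))).1 (congrFun h e)
    choose t ht using h'
    exact ⟨t, ht⟩
  · rintro ⟨t, ht⟩
    exact funext fun e =>
      (Submodule.Quotient.mk_eq_zero (LinearMap.range (X.inclusion.e e))).2 ⟨t e, ht e⟩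

theorem position_d2_projection (q : F → Plane) :
    X.position.d2 (X.projection.c2 q) = X.projection.c1 (X.dualDiff q) := rfl

theorem positionClass_projection_eq_zero_iff (x : E → Plane) :
    X.positionClass (X.projection.c1 x) = 0 ↔
      ∃ (q : F → Plane) (t : E → ℝ), ∀ e, x e = X.dualDiff q e + t e • X.edgeVec e := by
  rw [positionClass_eq_zero_iff]
  constructor
  · rintro ⟨y, hy⟩
    obtain ⟨q, rfl⟩ := X.projection_c2_surjective y
    rw [position_d2_projection] at hy
    obtain ⟨t, ht⟩ := (X.projection_c1_eq_zero_iff (x - X.dualDiff q)).1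
      ((map_sub X.projection.c1 _ _).trans (sub_eq_zero.2 hy.symm))
    exact ⟨q, t, fun e => by rw [ht e, Pi.sub_apply, add_sub_cancel]⟩
  · rintro ⟨q, t, h⟩
    refine ⟨X.projection.c2 q, ?_⟩
    rw [position_d2_projection]
    have := (X.projection_c1_eq_zero_iff (x - X.dualDiff q)).2
      ⟨t, fun e => by rw [Pi.sub_apply, h e, add_sub_cancel_left]⟩
    exact (sub_eq_zero.1 ((map_sub X.projection.c1 _ _).symm.trans this)).symm

theorem isForceDiagram_iff (q : F → Plane) :
    X.IsForceDiagram q ↔ ∃ w : E → ℝ, ∀ e, w e • X.edgeVec e = X.dualDiff q e :=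
  X.projection_c1_eq_zero_iff (X.dualDiff q)

/-- If `∂₁ x = ∂₁ (t dp)`, then `x - t dp` is a cycle of the constant cosheaf, hence some `d*q`.
Conversely `∂₁` kills the `d*q` part of `x = d*q + t dp`. -/
theorem mem_range_force_d1_iff (x : E → Plane) :
    X.ambient.d1 x ∈ LinearMap.range X.force.d1 ↔
      X.positionClass (X.projection.c1 x) = 0 := by
  rw [positionClass_projection_eq_zero_iff]
  constructor
  · rintro ⟨t, ht⟩
    obtain ⟨q, hq⟩ := X.exists_dualDiff_eq (x := x - fun e => t e • X.edgeVec e)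
      ((map_sub X.ambient.d1 _ _).trans (sub_eq_zero.2 (ht.symm.trans (X.force_d1 t))))
    exact ⟨q, t, fun e => by rw [hq, Pi.sub_apply, sub_add_cancel]⟩
  · rintro ⟨q, t, h⟩
    refine ⟨t, ?_⟩
    have hx : x = X.dualDiff q + fun e => t e • X.edgeVec e := funext h
    rw [hx, force_d1]
    refine ((map_add X.ambient.d1 _ _).trans ?_).symm
    rw [ambient_d1_dualDiff, zero_add]

/-! ### The homology of the constant cosheaf and the connecting homomorphism -/

/-- The zeroth homology of the constant cosheaf is the plane. -/
def ambientH0Equiv : X.ambient.H0 ≃ₗ[ℝ] Plane :=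
  (Submodule.quotEquivOfEq _ _ X.range_ambient_d1).trans
    ((vertexSum V).quotKerEquivOfSurjective
      (@vertexSum_surjective V _ X.nonempty_vertices))

theorem ambientH0Equiv_mk (c : V → Plane) :
    X.ambientH0Equiv (Submodule.Quotient.mk c) = ∑ v, c v :=
  vertexSum_apply c

theorem ambientH0Equiv_h0_mk (c : V → Plane) :
    X.ambientH0Equiv (X.inclusion.h0 (Submodule.Quotient.mk c)) = ∑ v, c v :=
  vertexSum_apply c

/-- The class in the homology of the position cosheaf of a chain of the constant cosheaf. -/
def chainClass : (E → Plane) →ₗ[ℝ] X.position.H1 := X.positionClass ∘ₗ X.projection.c1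

theorem chainClass_surjective : Function.Surjective X.chainClass :=
  X.positionClass_surjective.comp X.projection_c1_surjective

/-- The class in the homology of the force cosheaf of the boundary of a chain of the constant
cosheaf. -/
def boundaryClass : (E → Plane) →ₗ[ℝ] X.force.H0 :=
  Submodule.mkQ (LinearMap.range X.force.d1) ∘ₗ X.ambient.d1

/-- One inclusion makes the connecting map well defined, the other makes it injective. -/
theorem ker_boundaryClass : LinearMap.ker X.boundaryClass = LinearMap.ker X.chainClass := by
  ext x
  exact (Submodule.Quotient.mk_eq_zero _).trans (X.mem_range_force_d1_iff x)

/-- The connecting homomorphism. -/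
def connecting : X.position.H1 →ₗ[ℝ] X.force.H0 :=
  (LinearMap.ker X.chainClass).liftQ X.boundaryClass X.ker_boundaryClass.ge ∘ₗ
    (X.chainClass.quotKerEquivOfSurjective X.chainClass_surjective).symm.toLinearMap

theorem connecting_chainClass (x : E → Plane) :
    X.connecting (X.chainClass x) = X.boundaryClass x := by
  have h : (X.chainClass.quotKerEquivOfSurjective X.chainClass_surjective).symm
      (X.chainClass x) = Submodule.Quotient.mk x := by
    rw [LinearEquiv.symm_apply_eq]
    rfl
  simp only [connecting, LinearMap.comp_apply, LinearEquiv.coe_coe, h]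
  rfl

theorem connecting_injective : Function.Injective X.connecting := by
  rw [injective_iff_map_eq_zero]
  intro h hh
  obtain ⟨x, rfl⟩ := X.chainClass_surjective h
  rw [connecting_chainClass] at hh
  have : x ∈ LinearMap.ker X.chainClass := X.ker_boundaryClass ▸ LinearMap.mem_ker.2 hh
  exact this

/-- The image of the connecting map consists of the classes of boundaries `∂₁ x` of the constant
cosheaf, and these boundaries are the fields with sum zero. -/
theorem mk_mem_range_connecting_iff (c : V → Plane) :
    (Submodule.Quotient.mk c : X.force.H0) ∈ LinearMap.range X.connecting ↔ ∑ v, c v = 0 := by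
  constructor
  · rintro ⟨h, hh⟩
    obtain ⟨x, rfl⟩ := X.chainClass_surjective h
    rw [connecting_chainClass] at hh
    rw [← X.ambientH0Equiv_h0_mk, ← hh]
    exact (X.ambientH0Equiv_h0_mk _).trans (X.sum_ambient_d1 x)
  · intro hc
    have : c ∈ LinearMap.range X.ambient.d1 :=
      X.range_ambient_d1 ▸ LinearMap.mem_ker.2 ((vertexSum_apply c).trans hc)
    obtain ⟨x, rfl⟩ := this
    exact ⟨X.chainClass x, X.connecting_chainClass x⟩

theorem connecting_exact :
    Function.Exact X.connecting (X.ambientH0Equiv.toLinearMap ∘ₗ X.inclusion.h0) := by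
  intro y
  obtain ⟨c, rfl⟩ := Submodule.Quotient.mk_surjective _ y
  exact (Iff.of_eq (congrArg (· = (0 : Plane)) (X.ambientH0Equiv_h0_mk c))).trans
    (X.mk_mem_range_connecting_iff c).symm

theorem forceH0_to_plane_surjective :
    Function.Surjective (X.ambientH0Equiv.toLinearMap ∘ₗ X.inclusion.h0) := by
  intro t
  obtain ⟨c, hc⟩ := @vertexSum_surjective V _ X.nonempty_vertices t
  exact ⟨Submodule.Quotient.mk c, hc⟩

theorem isCompl_range_connecting_translations :
    IsCompl (LinearMap.range X.connecting)
      (LinearMap.range (X.dof ∘ₗ LinearMap.pi fun _ => LinearMap.id)) := by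
  have hV : (Fintype.card V : ℝ) ≠ 0 := by
    have := X.nonempty_vertices
    exact Nat.cast_ne_zero.2 Fintype.card_ne_zero
  have hsum (t : Plane) : ∑ _v : V, t = (Fintype.card V : ℝ) • t := by
    rw [Finset.sum_const, Finset.card_univ, Nat.cast_smul_eq_nsmul]
  constructor
  · rw [Submodule.disjoint_def]
    rintro _ h ⟨t, rfl⟩
    have h' := (X.mk_mem_range_connecting_iff fun _ => t).1 h
    rw [hsum, smul_eq_zero_iff_right hV] at h'
    rw [h', map_zero]
  · rw [codisjoint_iff, eq_top_iff]
    rintro y -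
    obtain ⟨c, rfl⟩ := Submodule.Quotient.mk_surjective _ y
    -- The translation part of `c` is its mean over the vertices; the remainder has sum zero.
    let t : Plane := (Fintype.card V : ℝ)⁻¹ • ∑ v, c v
    rw [Submodule.mem_sup]
    refine ⟨Submodule.Quotient.mk (c - fun _ => t),
      (X.mk_mem_range_connecting_iff _).2 ?_, _, ⟨t, rfl⟩, ?_⟩
    · simp only [Pi.sub_apply, Finset.sum_sub_distrib, hsum, t]
      rw [smul_inv_smul₀ hV, sub_self]
    · exact (Submodule.Quotient.mk_add _).symm.trans
        (congrArg Submodule.Quotient.mk (sub_add_cancel c fun _ => t))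

/-! ### Infinitesimal motions -/

theorem sum_inner_force_d1_eq_zero {u : V → Plane} (hu : u ∈ X.motions) (y : E → ℝ) :
    ∑ v, inner ℝ (u v) (X.force.d1 y v) = 0 := by
  rw [sum_inner_force_d1]
  exact Finset.sum_eq_zero fun e _ => by rw [hu e, mul_zero]

theorem mem_motions_of_orthogonal {u : V → Plane}
    (hu : ∀ r ∈ LinearMap.range X.force.d1, ∑ v, inner ℝ (u v) (r v) = 0) : u ∈ X.motions := by
  classical
  intro e
  -- The boundary of a unit stress on `e` alone isolates the length condition of that edge.
  have h := hu _ ⟨Pi.single e 1, rfl⟩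
  rw [sum_inner_force_d1] at h
  simpa [Pi.single_apply] using h

/-- The motions form the orthogonal complement of the image of `∂₁`, and a complement of a subspace
maps isomorphically onto the quotient. -/
theorem dof_motions_bijective : Function.Bijective (X.dof ∘ₗ X.motions.subtype) := by
  constructor
  · rw [injective_iff_map_eq_zero]
    rintro ⟨u, hu⟩ h
    obtain ⟨y, hy⟩ := (Submodule.Quotient.mk_eq_zero (LinearMap.range X.force.d1)).1 h
    refine Subtype.ext (eq_zero_of_sum_inner_self ?_)
    have h' := X.sum_inner_force_d1_eq_zero hu y
    rwa [hy] at h'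
  · intro y
    obtain ⟨c, rfl⟩ := Submodule.Quotient.mk_surjective _ y
    obtain ⟨r, hr, u, hu, rfl⟩ := exists_orthogonal_decomposition (LinearMap.range X.force.d1) c
    refine ⟨⟨u, X.mem_motions_of_orthogonal hu⟩, ?_⟩
    refine (Submodule.Quotient.eq (LinearMap.range X.force.d1)).2 ?_
    have : u - (r + u) = -r := by abel
    exact this ▸ Submodule.neg_mem _ hr

/-- Edge rotations of a motion, scaled by nonnegative weights, are realized by moving the dual
vertices only if they all vanish. -/
theorem smul_diff_eq_zero_of_dualDiff {u : V → Plane} (hu : u ∈ X.motions) {a : E → ℝ}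
    (ha : ∀ e, 0 ≤ a e) {q : F → Plane}
    (h : ∀ e, ∃ t : ℝ, X.dualDiff q e = a e • X.diff u e + t • X.edgeVec e) (e : E) :
    a e • X.diff u e = 0 := by
  choose t ht using h
  have hs := X.sum_inner_dualDiff_diff q u
  -- The axial term drops out because `⟨dp, du⟩ = 0`; what remains is a sum of nonnegative terms
  -- equal to zero.
  have hterm : ∀ e, inner ℝ (X.dualDiff q e) (X.diff u e) =
      a e * inner ℝ (X.diff u e) (X.diff u e) := by
    intro e
    rw [ht e, inner_add_left, real_inner_smul_left, real_inner_smul_left, hu e, mul_zero, add_zero]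
  simp_rw [hterm] at hs
  have h0 := (Finset.sum_eq_zero_iff_of_nonneg
    (fun e _ => mul_nonneg (ha e) (real_inner_self_nonneg (x := X.diff u e)))).1 hs e (Finset.mem_univ e)
  rcases mul_eq_zero.1 h0 with h | h
  · rw [h, zero_smul]
  · rw [inner_self_eq_zero.1 h, smul_zero]

theorem diff_eq_zero_of_dualDiff {u : V → Plane} (hu : u ∈ X.motions) {q : F → Plane}
    (h : ∀ e, ∃ t : ℝ, X.dualDiff q e = X.diff u e + t • X.edgeVec e) : X.diff u = 0 := by
  funext e
  have := X.smul_diff_eq_zero_of_dualDiff hu (a := fun _ => 1) (fun _ => zero_le_one) (q := q)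
    (by simpa only [one_smul] using h) e
  rwa [one_smul] at this

theorem positionClass_edgeRotation_eq_zero_iff {u : V → Plane} (hu : u ∈ X.motions) :
    X.positionClass (X.edgeRotation u) = 0 ↔ IsTranslation u := by
  rw [X.isTranslation_iff_diff_eq_zero]
  constructor
  · intro h
    obtain ⟨q, t, hq⟩ := (X.positionClass_projection_eq_zero_iff (X.diff u)).1 h
    exact X.diff_eq_zero_of_dualDiff hu (q := q) fun e => ⟨-t e, by rw [hq e]; simp⟩
  · intro h
    have : X.edgeRotation u = X.projection.c1 (X.diff u) := rfl
    rw [this, h, map_zero, map_zero]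

/-- By dimension: the motions have dimension `dim H₀ F = dim H₁ G + 2`, and at most two dimensions
are lost in passing to classes of edge rotations. -/
theorem exists_motion_edgeRotation (h : X.position.H1) :
    ∃ u ∈ X.motions, X.positionClass (X.edgeRotation u) = h := by
  let R : X.motions →ₗ[ℝ] X.position.H1 :=
    X.positionClass ∘ₗ X.edgeRotation ∘ₗ X.motions.subtype
  have hker : Module.finrank ℝ (LinearMap.ker R) ≤ 2 := by
    obtain ⟨v⟩ := X.nonempty_vertices
    -- The kernel consists of translations, which are determined by their value at one vertex.
    let ev : LinearMap.ker R →ₗ[ℝ] Plane :=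
      LinearMap.proj v ∘ₗ X.motions.subtype ∘ₗ (LinearMap.ker R).subtype
    have hev : Function.Injective ev := by
      rw [injective_iff_map_eq_zero]
      rintro ⟨⟨u, hu⟩, hR⟩ h0
      obtain ⟨t, ht⟩ := (X.positionClass_edgeRotation_eq_zero_iff hu).1 hR
      have h0' : u v = 0 := h0
      refine Subtype.ext (Subtype.ext (funext fun w => ?_))
      exact (ht w).trans ((ht v).symm.trans h0')
    simpa using LinearMap.finrank_le_finrank_of_injective hev
  have h1 := LinearMap.finrank_range_add_finrank_ker R
  have h2 := (LinearEquiv.ofBijective _ X.dof_motions_bijective).finrank_eq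
  have h3 := LinearMap.finrank_range_add_finrank_ker
    (X.ambientH0Equiv.toLinearMap ∘ₗ X.inclusion.h0)
  rw [LinearMap.range_eq_top.2 X.forceH0_to_plane_surjective, finrank_top,
    X.connecting_exact.linearMap_ker_eq, LinearMap.finrank_range_of_inj X.connecting_injective,
    finrank_euclideanSpace, Fintype.card_fin] at h3
  have h4 : LinearMap.range R = ⊤ := by
    have hle := Submodule.finrank_le (LinearMap.range R)
    exact Submodule.eq_top_of_finrank_eq (by omega)
  obtain ⟨u, hu⟩ := LinearMap.range_eq_top.1 h4 h
  exact ⟨u, u.2, hu⟩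

/-! ### Mechanisms and global rotations -/

theorem IsGlobalRotation.diff_eq {X : FormDiagram V E F} {u : V → Plane} {a : ℝ} {c : Plane}
    (h : ∀ v, u v = a • quarterTurn (X.p v - c)) (e : E) :
    X.diff u e = a • quarterTurn (X.edgeVec e) := by
  rw [diff_apply, h, h, ← smul_sub, ← quarterTurn_sub, sub_sub_sub_cancel_right]
  rfl

theorem mem_motions_and_not_isTranslation {u : V → Plane}
    (hu : X.IsMechanism u ∨ X.IsGlobalRotation u) : u ∈ X.motions ∧ ¬ IsTranslation u := by
  rcases hu with ⟨hu, hn⟩ | ⟨a, c, ha, h⟩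
  · refine ⟨hu, ?_⟩
    rintro ⟨t, ht⟩
    exact hn ⟨0, t, fun v => by rw [ht, zero_smul, zero_add]⟩
  · have hd := IsGlobalRotation.diff_eq h
    constructor
    · intro e
      rw [hd, inner_smul_right, inner_quarterTurn]
      ring
    · rw [X.isTranslation_iff_diff_eq_zero]
      intro h0
      obtain ⟨e⟩ := X.nonempty_edges
      have := hd e
      rw [h0] at this
      exact smul_ne_zero ha (quarterTurn_ne_zero (X.edgeVec_ne_zero e)) this.symm

end FormDiagram

end GraphicStatics

end

theorem theorem2 {V E F : Type*} [Fintype V] [Fintype E] [Fintype F]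
    (X : GraphicStatics.FormDiagram V E F) :
    -- `H₀` of the constant cosheaf is the plane, through the sum over the vertices
    ∃ s : X.ambient.H0 ≃ₗ[ℝ] GraphicStatics.Plane,
      (∀ c : V → GraphicStatics.Plane, s (Submodule.Quotient.mk c) = ∑ v, c v) ∧
    -- the connecting homomorphism of `0 → force → ambient → position → 0`
    ∃ δ : X.position.H1 →ₗ[ℝ] X.force.H0,
      (∀ (x : X.ambient.C1) (y : X.force.C0), X.inclusion.c0 y = X.ambient.d1 x →
        δ (X.positionClass (X.projection.c1 x)) = Submodule.Quotient.mk y) ∧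
      -- the sequence `0 → H₁ G → H₀ F → ℝ² → 0` is exact
      Function.Injective δ ∧
      Function.Exact δ (s.toLinearMap ∘ₗ X.inclusion.h0) ∧
      Function.Surjective (s.toLinearMap ∘ₗ X.inclusion.h0) ∧
      -- hence `H₀ F / H₁ G ≅ ℝ²`, and the global translations are a complement of `H₁ G`
      (∃ Φ : (X.force.H0 ⧸ LinearMap.range δ) ≃ₗ[ℝ] GraphicStatics.Plane,
        ∀ y : X.force.H0, Φ (Submodule.Quotient.mk y) = s (X.inclusion.h0 y)) ∧
      IsCompl (LinearMap.range δ)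
        (LinearMap.range (X.dof ∘ₗ LinearMap.pi fun _ => LinearMap.id)) ∧
    -- the infinitesimal motions of the truss represent `H₀ F`
    Function.Bijective (X.dof ∘ₗ X.motions.subtype) ∧
    -- the edge rotations of motions fill `H₁ G`, and only those of translations are realizable
    (∀ h : X.position.H1, ∃ u ∈ X.motions, X.positionClass (X.edgeRotation u) = h) ∧
    (∀ u ∈ X.motions, X.positionClass (X.edgeRotation u) = 0 ↔
      GraphicStatics.FormDiagram.IsTranslation u) ∧
    -- mechanisms and global rotations give impossible edge rotations
    ∀ u : V → GraphicStatics.Plane, X.IsMechanism u ∨ X.IsGlobalRotation u →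
      u ∈ X.motions ∧
      X.positionClass (X.edgeRotation u) ≠ 0 ∧
      -- no parallel force diagram `q` can be moved so that each dual edge is displaced, up to an
      -- axial extension, as the edge is displaced by `u`
      (∀ q : F → GraphicStatics.Plane, X.IsForceDiagram q → ∀ q' : F → GraphicStatics.Plane,
        ¬ ∀ e, ∃ t : ℝ, X.dualDiff q' e = X.dualDiff q e + X.diff u e + t • X.edgeVec e) ∧
      -- in terms of angular velocities `ω`, flipped according to the sign of the stress `w`
      ∀ q : F → GraphicStatics.Plane, X.IsForceDiagram q →
        ∃ w ω : E → ℝ, (∀ e, X.dualDiff q e = w e • X.edgeVec e) ∧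
          (∀ e, X.diff u e = ω e • GraphicStatics.quarterTurn (X.edgeVec e)) ∧
          ((∃ e, w e ≠ 0 ∧ ω e ≠ 0) → ∀ η : F → GraphicStatics.Plane,
            ¬ ∀ e, ∃ t : ℝ, X.dualDiff η e =
              (Real.sign (w e) * ω e) • GraphicStatics.quarterTurn (X.dualDiff q e) +
                t • X.edgeVec e) := by
  refine ⟨X.ambientH0Equiv, X.ambientH0Equiv_mk, X.connecting, fun x y hxy => ?_,
    X.connecting_injective, X.connecting_exact, X.forceH0_to_plane_surjective, ?_,
    X.isCompl_range_connecting_translations, X.dof_motions_bijective,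
    X.exists_motion_edgeRotation, fun u hu => X.positionClass_edgeRotation_eq_zero_iff hu,
    fun u hu => ?_⟩
  · refine (X.connecting_chainClass x).trans ?_
    exact congrArg Submodule.Quotient.mk hxy.symm
  · refine ⟨(Submodule.quotEquivOfEq _ _ X.connecting_exact.linearMap_ker_eq.symm).trans
      (LinearMap.quotKerEquivOfSurjective _ X.forceH0_to_plane_surjective), fun y => rfl⟩
  · obtain ⟨hmot, hnt⟩ := X.mem_motions_and_not_isTranslation hu
    refine ⟨hmot, fun h => hnt ((X.positionClass_edgeRotation_eq_zero_iff hmot).1 h),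
      fun q _ q' h => hnt ((X.isTranslation_iff_diff_eq_zero u).2 ?_), fun q hq => ?_⟩
    · refine X.diff_eq_zero_of_dualDiff hmot (q := q' - q) fun e => ?_
      obtain ⟨t, ht⟩ := h e
      refine ⟨t, ?_⟩
      have hsub : X.dualDiff (q' - q) e = X.dualDiff q' e - X.dualDiff q e := by
        simp only [GraphicStatics.FormDiagram.dualDiff, Pi.sub_apply]
        abel
      rw [hsub, ht]
      abel
    · obtain ⟨w, hw⟩ := (X.isForceDiagram_iff q).1 hq
      choose ω hω using fun e =>
        GraphicStatics.exists_eq_smul_quarterTurn (X.edgeVec_ne_zero e) (hmot e)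
      refine ⟨w, ω, fun e => (hw e).symm, hω, ?_⟩
      rintro ⟨e, hwe, hωe⟩ η h
      -- Since `d*q = w dp`, the prescribed term `sgn(w) ω J(d*q)` equals `|w| ω J dp = |w| du`. The
      -- sign flip is what makes the weights nonnegative.
      have h0 := X.smul_diff_eq_zero_of_dualDiff hmot (a := fun e => |w e|)
        (fun e => abs_nonneg _) (q := η) (fun e => ?_) e
      · rw [hω e, smul_smul, smul_eq_zero] at h0
        rcases h0 with h0 | h0
        · exact mul_ne_zero (abs_ne_zero.2 hwe) hωe h0
        · exact GraphicStatics.quarterTurn_ne_zero (X.edgeVec_ne_zero e) h0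
      · obtain ⟨t, ht⟩ := h e
        refine ⟨t, ?_⟩
        have hsign : Real.sign (w e) * ω e * w e = |w e| * ω e := by
          rcases lt_trichotomy (w e) 0 with h | h | h
          · rw [Real.sign_of_neg h, abs_of_neg h]; ring
          · simp [h]
          · rw [Real.sign_of_pos h, abs_of_pos h]; ring
        rw [ht, ← hw e, GraphicStatics.quarterTurn_smul, smul_smul, hsign, hω e, smul_smul]
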